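/- Let $N\ge 0$, $m\ge 1$ be integers and $\mathbb T^N=\mathbb R^N/\mathbb Z^N$. For $i=1,\dots,m$ let $H_i:\mathbb T^N\times\mathbb R^N\to\mathbb R$ be continuous, convex in the second variable, and such that $\alpha_i(|p|)\le H_i(x,p)\le\beta_i(|p|)$ for all $(x,p)$, where $\alpha_i,\beta_i:[0,\infty)\to\mathbb R$ tend to $+\infty$ at $+\infty$. Let $B(x)=(b_{ij}(x))$ be an $m\times m$ matrix depending continuously on $x\in\mathbb T^N$ such that, for every $x$: $b_{ij}(x)\le 0$ for $j\neq i$; $\sum_j b_{ij}(x)=0$ for every $i$; and for every nonempty $\mathcal I\subsetneq\{1,\dots,m\}$ there are $i\in\mathcal I$, $j\notin\mathcal I$ with $b_{ij}(x)\ne 0$. For $\mathbf a\in\mathbb R^m$, a continuous $\mathbf u=(u_1,\dots,u_m):\mathbb T^N\to\mathbb R^m$ is a (viscosity) subsolution of the system $$H_i(x,Du_i)+(B(x)\mathbf u(x))_i=a_i\quad\text{in }\mathbb T^N,\qquad i=1,\dots,m,$$ if $H_i(x,p)+(B(x)\mathbf u(x))_i\le a_i$ for all $x$, all $i$ and all $p\in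 D^+u_i(x)$; a supersolution if $H_i(x,p)+(B(x)\mathbf u(x))_i\ge a_i$ for all $x$, all $i$ and all $p\in D^-u_i(x)$; and a solution if it is both. Here $D^+u(x)$ (resp. $D^-u(x)$) is the set of the gradients $D\varphi(x)$ of the $C^1$ functions $\varphi$ defined near $x$ such that $u-\varphi$ has a local maximum (resp. minimum) at $x$. Let $\mathcal H(\mathbf a)$ be the set of subsolutions, and write $\mathcal H(a)=\mathcal H(a\mathbb 1)$ for $a\in\mathbb R$, where $\mathbb 1=(1,\dots,1)^T$. Assume that the critical value $c=\inf\{a\in\mathbb R:\mathcal H(a)\neq\varnothing\}$ is $0$. Sub- and supersolutions and solutions for $\mathbf a=0$ are called critical. The Mañé matrix is $$\Phi_{i,j}(y,x)=\sup_{\mathbf v\in\mathcal H(0)}\big(v_i(x)-v_j(y)\big),$$ and the Aubry set $\mathcal A$ is the set of $y\in\mathbb T^N$ such that $\Phi_{\cdot,i}(y,\cdot)$ is a critical solution for some index $i$ (equivalently, as the last item below shows, for every index $i$). **Theorem.** Let $y\in\mathcal A$. Then $\mathcal H(0)\ne\varnothing$, the suprema defining the Mañé matrix are all finite, and: 1.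 $\mathbf v(y)=\Phi_{\cdot,i}(y,y)+v_i(y)\,\mathbb 1$ for every $i\in\{1,\dots,m\}$ and every $\mathbf v\in\mathcal H(0)$; 2. $\mathbf v(y)-\mathbf w(y)\in\mathbb R\,\mathbb 1$ for all $\mathbf v,\mathbf w\in\mathcal H(0)$; 3. the matrix $\Phi(y,y)$ is antisymmetric; 4. every column $\Phi_{\cdot,j}(y,\cdot)$ is a critical solution, and any two columns differ by a constant: $\Phi_{\cdot,i}(y,x)=\Phi_{\cdot,j}(y,x)+\Phi_{j,i}(y,y)\,\mathbb 1$ for all $i,j$ and all $x\in\mathbb T^N$. -/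

import Mathlib

open scoped Topology NNReal Gradient Matrix

/-- The canonical projection from `ℝ^N` onto the flat torus `ℝ^N / ℤ^N`. -/
def torusProj {N : ℕ} (z : EuclideanSpace ℝ (Fin N)) : UnitAddTorus (Fin N) :=
  fun k => (z k : UnitAddCircle)

/-- The set `D⁺u(x)` of superdifferentials of a function on the torus: the gradients at `x` of the
`C¹` functions `φ`, defined near `x`, such that `u - φ` has a local maximum at `x`. Everything is
read in the covering space, at a point `z` lying over `x`; the choice of `z` does not matter, as
the lift of `u` is periodic. `ContDiffAt ℝ 1 φ z` says that `φ` is `C¹` in a neighbourhood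
of `z`. -/
def superdifferential {N : ℕ} (u : UnitAddTorus (Fin N) → ℝ) (x : UnitAddTorus (Fin N)) :
    Set (EuclideanSpace ℝ (Fin N)) :=
  {p | ∃ (z : EuclideanSpace ℝ (Fin N)) (φ : EuclideanSpace ℝ (Fin N) → ℝ),
    torusProj z = x ∧ ContDiffAt ℝ 1 φ z ∧ ∇ φ z = p ∧
      IsLocalMax (fun z' => u (torusProj z') - φ z') z}

/-- The set `D⁻u(x)` of subdifferentials of a function on the torus (local minimum instead of
local maximum). -/
def subdifferential {N : ℕ} (u : UnitAddTorus (Fin N) → ℝ) (x : UnitAddTorus (Fin N)) :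
    Set (EuclideanSpace ℝ (Fin N)) :=
  {p | ∃ (z : EuclideanSpace ℝ (Fin N)) (φ : EuclideanSpace ℝ (Fin N) → ℝ),
    torusProj z = x ∧ ContDiffAt ℝ 1 φ z ∧ ∇ φ z = p ∧
      IsLocalMin (fun z' => u (torusProj z') - φ z') z}

/-- A convex Hamiltonian on `𝕋^N × ℝ^N`: continuous, convex in the momentum, and bounded from
below and above by coercive functions of the norm of the momentum. -/
structure IsConvexHamiltonian {N : ℕ}
    (H : UnitAddTorus (Fin N) → EuclideanSpace ℝ (Fin N) → ℝ) : Prop where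
  continuous : Continuous fun q : UnitAddTorus (Fin N) × EuclideanSpace ℝ (Fin N) => H q.1 q.2
  convex : ∀ x, ConvexOn ℝ Set.univ (H x)
  coercive : ∃ α β : ℝ≥0 → ℝ,
    Filter.Tendsto α Filter.atTop Filter.atTop ∧ Filter.Tendsto β Filter.atTop Filter.atTop ∧
      ∀ x p, α ‖p‖₊ ≤ H x p ∧ H x p ≤ β ‖p‖₊

/-- Coupling matrices: nonpositive off-diagonal entries and nonnegative row sums. -/
structure IsCouplingMatrix {m : ℕ} (B : Matrix (Fin m) (Fin m) ℝ) : Prop where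
  offDiag_nonpos : ∀ i j, j ≠ i → B i j ≤ 0
  rowSum_nonneg : ∀ i, 0 ≤ ∑ j, B i j

/-- Degeneracy: all row sums vanish. -/
def IsDegenerateMatrix {m : ℕ} (B : Matrix (Fin m) (Fin m) ℝ) : Prop :=
  ∀ i, ∑ j, B i j = 0

/-- Irreducibility: every nonempty proper set of indices is linked to its complement. -/
def IsIrreducibleMatrix {m : ℕ} (B : Matrix (Fin m) (Fin m) ℝ) : Prop :=
  ∀ I : Set (Fin m), I.Nonempty → I ≠ Set.univ → ∃ i ∈ I, ∃ j ∉ I, B i j ≠ 0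

section System

variable {N m : ℕ} (H : Fin m → UnitAddTorus (Fin N) → EuclideanSpace ℝ (Fin N) → ℝ)
  (B : UnitAddTorus (Fin N) → Matrix (Fin m) (Fin m) ℝ)

/-- Continuous viscosity subsolutions of `H_i(x, Du_i) + (B(x)u(x))_i = a_i`, `i = 1, …, m`. -/
structure IsViscositySubsolution (a : Fin m → ℝ) (u : UnitAddTorus (Fin N) → Fin m → ℝ) :
    Prop where
  continuous : Continuous u
  le : ∀ x i, ∀ p ∈ superdifferential (fun x' => u x' i) x, H i x p + (B x *ᵥ u x) i ≤ a i

/-- Continuous viscosity supersolutions of `H_i(x, Du_i) + (B(x)u(x))_i = a_i`, `i = 1, …, m`. -/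
structure IsViscositySupersolution (a : Fin m → ℝ) (u : UnitAddTorus (Fin N) → Fin m → ℝ) :
    Prop where
  continuous : Continuous u
  ge : ∀ x i, ∀ p ∈ subdifferential (fun x' => u x' i) x, a i ≤ H i x p + (B x *ᵥ u x) i

/-- Viscosity solutions: both sub- and supersolutions. -/
def IsViscositySolution (a : Fin m → ℝ) (u : UnitAddTorus (Fin N) → Fin m → ℝ) : Prop :=
  IsViscositySubsolution H B a u ∧ IsViscositySupersolution H B a u

/-- The set `𝓗(a)` of subsolutions of the system with right-hand side `a`. -/
def subsolutions (a : Fin m → ℝ) : Set (UnitAddTorus (Fin N) → Fin m → ℝ) :=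
  {u | IsViscositySubsolution H B a u}

/-- The critical value: the infimum of the constants `a` for which the system with right-hand
side `(a, …, a)` has a subsolution. -/
noncomputable def criticalValue : ℝ :=
  sInf {a : ℝ | (subsolutions H B (fun _ => a)).Nonempty}

/-- The set of differences whose supremum is the entry `Φ_{i,j}(y,x)` of the Mañé matrix. -/
def maneSet (i j : Fin m) (y x : UnitAddTorus (Fin N)) : Set ℝ :=
  {r | ∃ v ∈ subsolutions H B 0, r = v x i - v y j}

/-- The Mañé matrix `Φ(y,x)`, with entries `Φ_{i,j}(y,x) = sup_{v ∈ 𝓗(0)} (v_i(x) - v_j(y))`. -/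
noncomputable def maneMatrix (y x : UnitAddTorus (Fin N)) : Matrix (Fin m) (Fin m) ℝ :=
  Matrix.of fun i j => sSup (maneSet H B i j y x)

/-- The Aubry set: the points `y` such that a column `Φ_{·,i}(y,·)` of the Mañé matrix is a
critical solution. -/
def aubrySet : Set (UnitAddTorus (Fin N)) :=
  {y | ∃ i : Fin m, IsViscositySolution H B 0 (fun x => (maneMatrix H B y x).col i)}

end System

/-! Let column `j₀` of the Mañé matrix based at `y` be a critical solution. For any critical
subsolution `v`, the translate `v - v_{j₀}(y) 𝟙` is again a subsolution, lies below that column by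
definition of the supremum, and meets it at `y` in component `j₀`. By `eq_of_contact` they then
agree at `y` in every component, so all differences `v_i(y) - v_k(y)` are independent of `v`. The
remaining claims are linear algebra.

`eq_of_contact` combines two facts. Doubling variables at a contact of the `i`-th components
produces one limiting momentum for both inequalities, so the Hamiltonian cancels and only the
coupling terms are compared (`mulVec_le_of_contact`). Irreducibility forbids this comparison at
every contact index unless all components touch (`exists_mulVec_neg`).

Finiteness of the suprema comes from uniform bounds on the oscillation between components and on the
Lipschitz constants of critical subsolutions. -/

theorem continuous_torusProj {N : ℕ} : Continuous (torusProj (N := N)) := by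
  refine continuous_pi fun k => ?_
  exact (AddCircle.continuous_mk' (1 : ℝ)).comp (EuclideanSpace.proj (𝕜 := ℝ) k).continuous

theorem torusProj_surjective {N : ℕ} : Function.Surjective (torusProj (N := N)) := by
  intro x
  choose t ht using fun k => QuotientAddGroup.mk_surjective (x k)
  exact ⟨WithLp.toLp 2 t, funext fun k => ht k⟩

theorem exists_abs_le_of_continuous {X : Type*} [TopologicalSpace X] [CompactSpace X] {u : X → ℝ}
    (hu : Continuous u) : ∃ C, 0 ≤ C ∧ ∀ x, |u x| ≤ C := by
  obtain ⟨C, hC⟩ := isCompact_univ.exists_bound_of_continuousOn hu.continuousOn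
  exact ⟨max C 0, le_max_right _ _, fun x => (hC x trivial).trans (le_max_left _ _)⟩

/-! ### Test functions and their gradients. -/

section Gradient

variable {E : Type*} [NormedAddCommGroup E] [InnerProductSpace ℝ E]

theorem contDiff_quadratic (a b : ℝ) (c d : E) :
    ContDiff ℝ 1 (fun z => a * ‖z - c‖ ^ 2 + b * ‖z - d‖ ^ 2) :=
  (contDiff_const.mul ((contDiff_id.sub contDiff_const).norm_sq ℝ)).add
    (contDiff_const.mul ((contDiff_id.sub contDiff_const).norm_sq ℝ))

theorem contDiffAt_mul_norm_sub (L : ℝ) {c x : E} (hx : x ≠ c) :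
    ContDiffAt ℝ 1 (fun z => L * ‖z - c‖) x :=
  contDiffAt_const.mul ((contDiffAt_id.sub contDiffAt_const).norm ℝ (sub_ne_zero.2 hx))

variable [CompleteSpace E]

theorem hasGradientAt_norm_sub_sq (c x : E) :
    HasGradientAt (fun z => ‖z - c‖ ^ 2) ((2 : ℝ) • (x - c)) x := by
  rw [hasGradientAt_iff_hasFDerivAt]
  have h := ((hasFDerivAt_id x).sub_const c).norm_sq
  refine h.congr_fderiv ?_
  ext v
  simp

theorem hasGradientAt_quadratic (a b : ℝ) (c d x : E) :
    HasGradientAt (fun z => a * ‖z - c‖ ^ 2 + b * ‖z - d‖ ^ 2)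
      ((2 * a) • (x - c) + (2 * b) • (x - d)) x := by
  have h := ((hasGradientAt_norm_sub_sq c x).hasFDerivAt.const_mul a).add
    ((hasGradientAt_norm_sub_sq d x).hasFDerivAt.const_mul b)
  rw [hasGradientAt_iff_hasFDerivAt]
  refine h.congr_fderiv ?_
  ext v
  simp
  ring

theorem norm_gradient_mul_norm_sub {L : ℝ} (hL : 0 ≤ L) {c x : E} (hx : x ≠ c) :
    ‖∇ (fun z => L * ‖z - c‖) x‖ = L := by
  have hne : x - c ≠ 0 := sub_ne_zero.2 hx
  have : Nontrivial E := ⟨x, c, hx⟩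
  have hd : DifferentiableAt ℝ (fun z : E => ‖z‖) (x - c) :=
    (contDiffAt_norm ℝ (n := 1) hne).differentiableAt one_ne_zero
  rw [gradient, LinearIsometryEquiv.norm_map]
  have h1 : fderiv ℝ (fun z => L * ‖z - c‖) x = L • fderiv ℝ (fun z : E => ‖z‖) (x - c) := by
    have := hd.hasFDerivAt.comp x ((hasFDerivAt_id x).sub_const c)
    exact (this.const_mul L).fderiv
  rw [h1, norm_smul, norm_fderiv_norm hd, Real.norm_of_nonneg hL, mul_one]

end Gradient

/-! ### Super- and subdifferentials of continuous functions on the torus. -/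

/-- Points with nonempty superdifferential are dense. -/
theorem dense_superdifferential_nonempty {N : ℕ} {u : UnitAddTorus (Fin N) → ℝ}
    (hu : Continuous u) :
    Dense {z : EuclideanSpace ℝ (Fin N) | (superdifferential u (torusProj z)).Nonempty} := by
  refine Metric.dense_iff.2 fun z₀ r hr => ?_
  obtain ⟨C, hC0, hC⟩ := exists_abs_le_of_continuous hu
  -- On the sphere of radius `r` the penalty is `2C + 1`, more than `u` can vary, so the maximum is
  -- interior.
  set φ : EuclideanSpace ℝ (Fin N) → ℝ := fun z =>
    ((2 * C + 1) / r ^ 2) * ‖z - z₀‖ ^ 2 + 0 * ‖z - z₀‖ ^ 2 with hφ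
  have hφc : ContDiff ℝ 1 φ := contDiff_quadratic _ _ _ _
  obtain ⟨z, hz, hmax⟩ := (isCompact_closedBall z₀ r).exists_isMaxOn
    (Metric.nonempty_closedBall.2 hr.le) (f := fun z => u (torusProj z) - φ z)
    ((hu.comp continuous_torusProj).sub hφc.continuous).continuousOn
  have hzr : dist z z₀ < r := by
    refine lt_of_le_of_ne hz fun h => ?_
    have h0 := hmax (Metric.mem_closedBall_self hr.le)
    simp only [hφ, Set.mem_ofPred_eq, ← dist_eq_norm, h] at h0
    rw [div_mul_cancel₀ _ (by positivity)] at h0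
    have h1 := abs_le.1 (hC (torusProj z))
    have h2 := abs_le.1 (hC (torusProj z₀))
    norm_num at h0
    linarith
  refine ⟨z, hzr, ∇ φ z, z, φ, rfl, hφc.contDiffAt, rfl, hmax.isLocalMax ?_⟩
  exact Filter.mem_of_superset (Metric.isOpen_ball.mem_nhds hzr) Metric.ball_subset_closedBall

/-- A function whose superdifferentials are bounded by `κ` is Lipschitz, with any larger
constant. -/
theorem sub_le_of_superdifferential_bounded {N : ℕ} {u : UnitAddTorus (Fin N) → ℝ}
    (hu : Continuous u) {κ L : ℝ} (hκ : ∀ x, ∀ p ∈ superdifferential u x, ‖p‖ ≤ κ)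
    (hL0 : 0 < L) (hL : κ < L) (z z₀ : EuclideanSpace ℝ (Fin N)) :
    u (torusProj z) - u (torusProj z₀) ≤ L * ‖z - z₀‖ := by
  obtain ⟨C, hC0, hC⟩ := exists_abs_le_of_continuous hu
  have hcont : Continuous fun z => u (torusProj z) - L * ‖z - z₀‖ :=
    (hu.comp continuous_torusProj).sub (by fun_prop)
  have hlim : Filter.Tendsto (fun z => u (torusProj z) - L * ‖z - z₀‖)
      (Filter.cocompact _) Filter.atBot := by
    have h1 : Filter.Tendsto (fun z => L * ‖z - z₀‖)
        (Filter.cocompact (EuclideanSpace ℝ (Fin N))) Filter.atTop := by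
      refine Filter.Tendsto.const_mul_atTop hL0 ?_
      simpa only [dist_eq_norm] using tendsto_dist_right_cocompact_atTop z₀
    have h2 := Filter.tendsto_atBot_add_const_left _ C (Filter.tendsto_neg_atTop_atBot.comp h1)
    refine Filter.tendsto_atBot_mono (fun z => ?_) h2
    have := abs_le.1 (hC (torusProj z))
    simp only [Function.comp]
    linarith
  obtain ⟨w, hw⟩ := hcont.exists_forall_ge hlim
  by_cases h : w = z₀
  · subst h
    have := hw z
    simp only [sub_self, norm_zero, mul_zero, sub_zero] at this
    linarith
  -- Away from its vertex the cone is `C¹` with slope `L > κ`, so it cannot touch `u` from above.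
  · refine absurd (hκ (torusProj w) (∇ (fun z => L * ‖z - z₀‖) w)
      ⟨w, _, rfl, contDiffAt_mul_norm_sub L h, rfl, Filter.Eventually.of_forall hw⟩) ?_
    rw [norm_gradient_mul_norm_sub hL0.le h]
    exact not_le.2 hL

/-- Doubling of variables at a contact point of `f ≤ g`. -/
theorem exists_near_superdifferential_subdifferential {N : ℕ}
    {f g : UnitAddTorus (Fin N) → ℝ} (hf : Continuous f) (hg : Continuous g)
    (hfg : ∀ x, f x ≤ g x) {y : EuclideanSpace ℝ (Fin N)}
    (hy : f (torusProj y) = g (torusProj y)) {r : ℝ} (hr : 0 < r) :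
    ∃ x z, dist x y < r ∧ dist z y < r ∧ ∃ p ∈ superdifferential f (torusProj x),
      ∃ q ∈ subdifferential g (torusProj z), dist p q < r := by
  obtain ⟨Cf, hCf0, hCf⟩ := exists_abs_le_of_continuous hf
  obtain ⟨Cg, hCg0, hCg⟩ := exists_abs_le_of_continuous hg
  have hf' := hf.comp (continuous_torusProj (N := N))
  have hg' := hg.comp (continuous_torusProj (N := N))
  have hK := isCompact_closedBall y r
  -- `r² / 16 = (1/4)(r/2)²`: with the penalty `‖x - y‖² / 4` below, this gives `‖x - y‖ < r / 2`.
  obtain ⟨η, hη, hunif⟩ := Metric.uniformContinuousOn_iff.1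
    (hK.uniformContinuousOn_of_continuous hf'.continuousOn) (r ^ 2 / 16) (by positivity)
  set ρ := min η (r / 2) with hρ
  have hρ0 : 0 < ρ := lt_min hη (by positivity)
  -- Makes `n ρ²` exceed every value of `f - g`, which forces `‖x - z‖ < ρ`.
  set n : ℝ := (Cf + Cg + 1) / ρ ^ 2 with hn
  have hn0 : 0 < n := by positivity
  obtain ⟨⟨x, z⟩, ⟨hx, hz⟩, hmax⟩ := (hK.prod hK).exists_isMaxOn
    ⟨(y, y), Metric.mem_closedBall_self hr.le, Metric.mem_closedBall_self hr.le⟩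
    (f := fun q => f (torusProj q.1) - g (torusProj q.2) - (1 / 4 * ‖q.1 - y‖ ^ 2
      + n * ‖q.1 - q.2‖ ^ 2))
    (((hf'.comp continuous_fst).sub (hg'.comp continuous_snd)).sub (by fun_prop)).continuousOn
  have h0 : 1 / 4 * ‖x - y‖ ^ 2 + n * ‖x - z‖ ^ 2 ≤ f (torusProj x) - g (torusProj z) := by
    have := hmax (show (y, y) ∈ _ from
      ⟨Metric.mem_closedBall_self hr.le, Metric.mem_closedBall_self hr.le⟩)
    simp only [Set.mem_ofPred_eq, sub_self, norm_zero, hy] at this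
    norm_num at this
    linarith
  have hxz : ‖x - z‖ < ρ := by
    have h1 := abs_le.1 (hCf (torusProj x))
    have h2 := abs_le.1 (hCg (torusProj z))
    have h3 : n * ‖x - z‖ ^ 2 < n * ρ ^ 2 := by
      rw [hn, div_mul_cancel₀ _ (by positivity), ← hn]
      nlinarith [sq_nonneg ‖x - y‖]
    exact lt_of_pow_lt_pow_left₀ 2 hρ0.le (lt_of_mul_lt_mul_left h3 hn0.le)
  have hxy : dist x y < r / 2 := by
    have h1 := hunif x hx z hz (by rw [dist_eq_norm]; exact hxz.trans_le (min_le_left _ _))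
    rw [Real.dist_eq] at h1
    have h2 := (abs_lt.1 h1).2
    simp only [Function.comp] at h2
    have h3 := hfg (torusProj z)
    have h4 : 0 ≤ n * ‖x - z‖ ^ 2 := by positivity
    rw [dist_eq_norm]
    refine lt_of_pow_lt_pow_left₀ 2 (by positivity) ?_
    nlinarith
  have hzy : dist z y < r := by
    have h1 := dist_triangle z x y
    have h2 : dist z x < r / 2 := by
      rw [dist_comm, dist_eq_norm]
      exact hxz.trans_le (min_le_right _ _)
    linarith
  have hxr : dist x y < r := by linarith
  refine ⟨x, z, hxr, hzy, (2 * (1 / 4 : ℝ)) • (x - y) + (2 * n) • (x - z),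
    ⟨x, _, rfl, (contDiff_quadratic (1 / 4) n y z).contDiffAt,
      (hasGradientAt_quadratic _ _ _ _ _).gradient, ?_⟩,
    (2 * (-n)) • (z - x) + (2 * 0 : ℝ) • (z - x),
    ⟨z, _, rfl, (contDiff_quadratic (-n) 0 x x).contDiffAt,
      (hasGradientAt_quadratic _ _ _ _ _).gradient, ?_⟩, ?_⟩
  · filter_upwards [Metric.isOpen_ball.mem_nhds hxr] with x' hx'
    have := hmax (show (x', z) ∈ _ from ⟨Metric.ball_subset_closedBall hx', hz⟩)
    simp only [Set.mem_ofPred_eq] at this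
    linarith
  · filter_upwards [Metric.isOpen_ball.mem_nhds hzy] with z' hz'
    have := hmax (show (x, z') ∈ _ from ⟨hx, Metric.ball_subset_closedBall hz'⟩)
    simp only [Set.mem_ofPred_eq] at this
    rw [norm_sub_rev z' x, norm_sub_rev z x]
    linarith
  -- The large terms in `n` cancel; only the gradient of the localizing term survives.
  · have : (2 * (1 / 4 : ℝ)) • (x - y) + (2 * n) • (x - z)
        - ((2 * (-n)) • (z - x) + (2 * 0 : ℝ) • (z - x)) = (1 / 2 : ℝ) • (x - y) := by
      module
    rw [dist_eq_norm, this, norm_smul, ← dist_eq_norm]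
    norm_num
    linarith [dist_nonneg (x := x) (y := y)]

/-! ### Consequences of coercivity. -/

namespace IsConvexHamiltonian

variable {N : ℕ} {H : UnitAddTorus (Fin N) → EuclideanSpace ℝ (Fin N) → ℝ}

theorem exists_norm_le (hH : IsConvexHamiltonian H) (C : ℝ) :
    ∃ κ, 0 ≤ κ ∧ ∀ x p, H x p ≤ C → ‖p‖ ≤ κ := by
  obtain ⟨α, β, hα, -, h⟩ := hH.coercive
  obtain ⟨R, hR⟩ := Filter.eventually_atTop.1 (hα.eventually_gt_atTop C)
  refine ⟨R, R.2, fun x p hp => ?_⟩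
  by_contra! hlt
  exact absurd ((hR ‖p‖₊ hlt.le).trans_le (h x p).1) (not_lt.2 hp)

theorem exists_neg_le (hH : IsConvexHamiltonian H) : ∃ K, 0 ≤ K ∧ ∀ x p, -K ≤ H x p := by
  obtain ⟨κ, hκ0, hκ⟩ := hH.exists_norm_le 0
  obtain ⟨K, hK⟩ := (isCompact_univ.prod
    (isCompact_closedBall (0 : EuclideanSpace ℝ (Fin N)) κ)).exists_bound_of_continuousOn
      hH.continuous.continuousOn
  refine ⟨max K 0, le_max_right _ _, fun x p => ?_⟩
  by_cases hp : H x p ≤ 0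
  · have := hK (x, p) ⟨trivial, mem_closedBall_zero_iff.2 (hκ x p hp)⟩
    exact (neg_le_neg (le_max_left _ _)).trans (abs_le.1 this).1
  · exact (neg_nonpos.2 (le_max_right _ _)).trans (not_le.1 hp).le

end IsConvexHamiltonian

/-! ### Linear algebra of the coupling matrix. -/

section Coupling

variable {m : ℕ}

theorem IsDegenerateMatrix.mulVec_const {B : Matrix (Fin m) (Fin m) ℝ}
    (hB : IsDegenerateMatrix B) (c : ℝ) : (B *ᵥ fun _ => c) = 0 := by
  ext i
  simp [Matrix.mulVec, dotProduct, ← Finset.sum_mul, hB i]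

/-- If `w ≥ 0` vanishes at some index but not at every index, then `B w` is negative at some index
where `w` vanishes. -/
theorem exists_mulVec_neg {B : Matrix (Fin m) (Fin m) ℝ} (hB : IsCouplingMatrix B)
    (hirr : IsIrreducibleMatrix B) {w : Fin m → ℝ} (hw : ∀ i, 0 ≤ w i) {a b : Fin m}
    (ha : w a = 0) (hb : w b ≠ 0) : ∃ i, w i = 0 ∧ (B *ᵥ w) i < 0 := by
  obtain ⟨i, hi, j, hj, hij⟩ := hirr {i | w i = 0} ⟨a, ha⟩ fun h => hb (h.ge (Set.mem_univ b))
  have hne : j ≠ i := fun h => hj (h ▸ hi)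
  refine ⟨i, hi, Finset.sum_neg' (fun k _ => ?_) ⟨j, Finset.mem_univ _, ?_⟩⟩
  · by_cases hk : k = i
    · rw [hk, show w i = 0 from hi, mul_zero]
    · exact mul_nonpos_of_nonpos_of_nonneg (hB.offDiag_nonpos i k hk) (hw k)
  · exact mul_neg_of_neg_of_pos (lt_of_le_of_ne (hB.offDiag_nonpos i j hne) hij)
      (lt_of_le_of_ne (hw j) (Ne.symm hj))

/-- Compactness makes `exists_mulVec_neg` quantitative: on vectors in the unit cube attaining both 0
and 1, the negative part of `B w` has a uniform positive lower bound. It is applied to `(max u - u)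
/ osc u`; since `B` kills constants, its image is `-(B u) / osc u`. -/
theorem exists_osc_le {X : Type*} [TopologicalSpace X] [CompactSpace X]
    {B : X → Matrix (Fin m) (Fin m) ℝ} (hBcont : ∀ i j, Continuous fun x => B x i j)
    (hB : ∀ x, IsCouplingMatrix (B x)) (hirr : ∀ x, IsIrreducibleMatrix (B x))
    (hdeg : ∀ x, IsDegenerateMatrix (B x)) (K : ℝ) :
    ∃ M, 0 ≤ M ∧ ∀ x (u : Fin m → ℝ), (∀ i, (B x *ᵥ u) i ≤ K) → ∀ i j, u i - u j ≤ M := by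
  set S : Set (X × (Fin m → ℝ)) :=
    Set.univ ×ˢ ((Set.univ.pi fun _ => Set.Icc 0 1) ∩ ⋃ a, ⋃ b, {w | w a = 0 ∧ w b = 1}) with hS
  have hScomp : IsCompact S := by
    refine isCompact_univ.prod ((isCompact_univ_pi fun _ => isCompact_Icc).inter_right ?_)
    refine isClosed_iUnion_of_finite fun a => isClosed_iUnion_of_finite fun b => ?_
    exact (isClosed_eq (continuous_apply a) continuous_const).inter
      (isClosed_eq (continuous_apply b) continuous_const)
  -- The index with a negative entry depends on the point; summing negative parts yields one
  -- continuous function.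
  set F : X × (Fin m → ℝ) → ℝ := fun q => ∑ i, max 0 (-(B q.1 *ᵥ q.2) i) with hF
  have hFcont : Continuous F := by
    refine continuous_finsetSum _ fun i _ => continuous_const.max (Continuous.neg ?_)
    simp only [Matrix.mulVec, dotProduct]
    fun_prop
  have hFpos : ∀ q ∈ S, 0 < F q := by
    rintro ⟨x, w⟩ ⟨-, hw, hab⟩
    simp only [Set.mem_iUnion] at hab
    obtain ⟨a, b, ha, hb⟩ := hab
    obtain ⟨i, -, hi⟩ := exists_mulVec_neg (hB x) (hirr x) (fun i => (hw i trivial).1) ha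
      (hb.trans_ne one_ne_zero)
    exact Finset.sum_pos' (fun _ _ => le_max_left _ _)
      ⟨i, Finset.mem_univ _, lt_max_of_lt_right (neg_pos.2 hi)⟩
  obtain ⟨δ, hδ, hδF⟩ : ∃ δ, 0 < δ ∧ ∀ q ∈ S, δ ≤ F q := by
    rcases S.eq_empty_or_nonempty with h | h
    · exact ⟨1, one_pos, by simp [h]⟩
    · obtain ⟨q, hq, hmin⟩ := hScomp.exists_isMinOn h hFcont.continuousOn
      exact ⟨F q, hFpos q hq, fun q' hq' => hmin hq'⟩
  refine ⟨m * max 0 K / δ, by positivity, fun x u hu i j => ?_⟩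
  have : Nonempty (Fin m) := ⟨i⟩
  obtain ⟨a, ha⟩ := Finite.exists_max u
  obtain ⟨b, hb⟩ := Finite.exists_min u
  have hij : u i - u j ≤ u a - u b := sub_le_sub (ha i) (hb j)
  refine hij.trans ?_
  rcases (sub_nonneg.2 (ha b)).eq_or_lt with h | h
  · rw [← h]; positivity
  set s := u a - u b with hs
  have hmem : (x, fun k => (u a - u k) / s) ∈ S := by
    refine ⟨trivial, fun k _ => ⟨div_nonneg (sub_nonneg.2 (ha k)) h.le, ?_⟩, ?_⟩
    · exact (div_le_one h).2 (sub_le_sub_left (hb k) _)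
    · simp only [Set.mem_iUnion]
      exact ⟨a, b, by simp, div_self h.ne'⟩
  have h1 := hδF _ hmem
  have h2 : (B x *ᵥ fun k => (u a - u k) / s) = -(s⁻¹ • (B x *ᵥ u)) := by
    have : (fun k => (u a - u k) / s) = s⁻¹ • ((fun _ => u a) - u) := by
      ext k; simp [div_eq_inv_mul]
    rw [this, Matrix.mulVec_smul, Matrix.mulVec_sub, (hdeg x).mulVec_const, zero_sub, smul_neg]
  have h3 : F (x, fun k => (u a - u k) / s) ≤ ∑ _i : Fin m, max 0 K / s := by
    refine Finset.sum_le_sum fun k _ => ?_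
    simp only [h2, Pi.neg_apply, neg_neg, Pi.smul_apply, smul_eq_mul]
    refine max_le (by positivity) ?_
    rw [inv_mul_eq_div]
    exact div_le_div_of_nonneg_right ((hu k).trans (le_max_right _ _)) h.le
  simp only [Finset.sum_const, Finset.card_univ, Fintype.card_fin, nsmul_eq_mul] at h3
  have h4 := h1.trans h3
  rw [← mul_div_assoc, le_div_iff₀ h] at h4
  rw [le_div_iff₀ hδ]
  linarith

end Coupling

/-! ### A priori bounds and comparison for the system. -/

section System

variable {N m : ℕ} {H : Fin m → UnitAddTorus (Fin N) → EuclideanSpace ℝ (Fin N) → ℝ}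
  {B : UnitAddTorus (Fin N) → Matrix (Fin m) (Fin m) ℝ}

theorem continuous_mulVec_apply (hBcont : ∀ i j, Continuous fun x => B x i j)
    {u : UnitAddTorus (Fin N) → Fin m → ℝ} (hu : Continuous u) (i : Fin m) :
    Continuous fun x => (B x *ᵥ u x) i := by
  simp only [Matrix.mulVec, dotProduct]
  fun_prop

theorem exists_osc_le_of_subsolution (hH : ∀ i, IsConvexHamiltonian (H i))
    (hBcont : ∀ i j, Continuous fun x => B x i j) (hB : ∀ x, IsCouplingMatrix (B x))
    (hirr : ∀ x, IsIrreducibleMatrix (B x)) (hdeg : ∀ x, IsDegenerateMatrix (B x)) :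
    ∃ M, 0 ≤ M ∧ ∀ u ∈ subsolutions H B 0, ∀ x i j, u x i - u x j ≤ M := by
  choose K hK0 hK using fun i => (hH i).exists_neg_le
  obtain ⟨M, hM0, hM⟩ := exists_osc_le hBcont hB hirr hdeg (∑ i, K i)
  refine ⟨M, hM0, fun u hu x => hM x (u x) fun i => ?_⟩
  have hcont := (continuous_mulVec_apply hBcont hu.continuous i).comp
    (continuous_torusProj (N := N))
  have hcl : IsClosed {z : EuclideanSpace ℝ (Fin N) |
      (B (torusProj z) *ᵥ u (torusProj z)) i ≤ ∑ i, K i} := isClosed_le hcont continuous_const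
  obtain ⟨z, rfl⟩ := torusProj_surjective x
  -- The equation bounds the coupling term only where a superdifferential exists; density and
  -- continuity extend the bound.
  refine hcl.closure_subset_iff.2 ?_ (dense_superdifferential_nonempty
    ((continuous_apply i).comp hu.continuous) z)
  rintro z ⟨p, hp⟩
  have h1 := hu.le _ i p hp
  have h2 := hK i (torusProj z) p
  have h3 := Finset.single_le_sum (fun j _ => hK0 j) (Finset.mem_univ i)
  simp only [Pi.zero_apply] at h1
  simp only [Set.mem_ofPred_eq]
  linarith

/-- Zero row sums express the coupling through differences of components, which are bounded; so `H i
x p` is bounded above and coercivity applies. -/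
theorem exists_superdifferential_bound (hH : ∀ i, IsConvexHamiltonian (H i))
    (hBcont : ∀ i j, Continuous fun x => B x i j) (hB : ∀ x, IsCouplingMatrix (B x))
    (hirr : ∀ x, IsIrreducibleMatrix (B x)) (hdeg : ∀ x, IsDegenerateMatrix (B x)) (i : Fin m) :
    ∃ κ, 0 ≤ κ ∧ ∀ u ∈ subsolutions H B 0, ∀ x,
      ∀ p ∈ superdifferential (fun x' => u x' i) x, ‖p‖ ≤ κ := by
  obtain ⟨M, hM0, hM⟩ := exists_osc_le_of_subsolution hH hBcont hB hirr hdeg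
  choose b hb0 hb using fun j => exists_abs_le_of_continuous (hBcont i j)
  obtain ⟨κ, hκ0, hκ⟩ := (hH i).exists_norm_le (∑ j, b j * M)
  refine ⟨κ, hκ0, fun u hu x p hp => hκ x p ?_⟩
  have h1 := hu.le x i p hp
  have h2 : (B x *ᵥ u x) i = ∑ j, B x i j * (u x j - u x i) := by
    simp only [mul_sub, Finset.sum_sub_distrib, ← Finset.sum_mul, hdeg x i, zero_mul, sub_zero]
    rfl
  have h3 : -∑ j, b j * M ≤ (B x *ᵥ u x) i := by
    rw [h2, ← Finset.sum_neg_distrib]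
    refine Finset.sum_le_sum fun j _ => neg_le_of_abs_le ?_
    rw [abs_mul]
    refine mul_le_mul (hb j x) (abs_sub_le_iff.2 ⟨hM u hu x j i, hM u hu x i j⟩)
      (abs_nonneg _) (hb0 j)
  simp only [Pi.zero_apply] at h1
  linarith

theorem bddAbove_maneSet (hH : ∀ i, IsConvexHamiltonian (H i))
    (hBcont : ∀ i j, Continuous fun x => B x i j) (hB : ∀ x, IsCouplingMatrix (B x))
    (hirr : ∀ x, IsIrreducibleMatrix (B x)) (hdeg : ∀ x, IsDegenerateMatrix (B x))
    (i j : Fin m) (x z : UnitAddTorus (Fin N)) : BddAbove (maneSet H B i j x z) := by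
  obtain ⟨M, -, hM⟩ := exists_osc_le_of_subsolution hH hBcont hB hirr hdeg
  obtain ⟨κ, hκ0, hκ⟩ := exists_superdifferential_bound hH hBcont hB hirr hdeg i
  obtain ⟨x, rfl⟩ := torusProj_surjective x
  obtain ⟨z, rfl⟩ := torusProj_surjective z
  refine ⟨(κ + 1) * ‖z - x‖ + M, ?_⟩
  rintro _ ⟨v, hv, rfl⟩
  have h1 := sub_le_of_superdifferential_bounded ((continuous_apply i).comp hv.continuous)
    (hκ v hv) (by linarith) (lt_add_one κ) z x
  have h2 := hM v hv (torusProj x) i j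
  simp only [Function.comp] at h1
  linarith

theorem superdifferential_add_const (u : UnitAddTorus (Fin N) → ℝ) (c : ℝ)
    (x : UnitAddTorus (Fin N)) :
    superdifferential (fun x' => u x' + c) x = superdifferential u x := by
  simp only [superdifferential, IsLocalMax, IsMaxFilter, add_sub_right_comm, add_le_add_iff_right]

theorem subdifferential_add_const (u : UnitAddTorus (Fin N) → ℝ) (c : ℝ)
    (x : UnitAddTorus (Fin N)) :
    subdifferential (fun x' => u x' + c) x = subdifferential u x := by
  simp only [subdifferential, IsLocalMin, IsMinFilter, add_sub_right_comm, add_le_add_iff_right]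

theorem IsDegenerateMatrix.mulVec_add_const {A : Matrix (Fin m) (Fin m) ℝ}
    (hA : IsDegenerateMatrix A) (u : Fin m → ℝ) (c : ℝ) :
    (A *ᵥ fun i => u i + c) = A *ᵥ u := by
  rw [show (fun i => u i + c) = u + fun _ => c from rfl, Matrix.mulVec_add, hA.mulVec_const,
    add_zero]

theorem IsViscositySubsolution.add_const (hdeg : ∀ x, IsDegenerateMatrix (B x)) {a : Fin m → ℝ}
    {u : UnitAddTorus (Fin N) → Fin m → ℝ} (hu : IsViscositySubsolution H B a u) (c : ℝ) :
    IsViscositySubsolution H B a fun x i => u x i + c where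
  continuous := continuous_pi fun i =>
    ((continuous_apply i).comp hu.continuous).add continuous_const
  le x i p hp := by
    rw [(hdeg x).mulVec_add_const]
    rw [superdifferential_add_const (fun x' => u x' i)] at hp
    exact hu.le x i p hp

theorem IsViscositySupersolution.add_const (hdeg : ∀ x, IsDegenerateMatrix (B x))
    {a : Fin m → ℝ} {u : UnitAddTorus (Fin N) → Fin m → ℝ}
    (hu : IsViscositySupersolution H B a u) (c : ℝ) :
    IsViscositySupersolution H B a fun x i => u x i + c where
  continuous := continuous_pi fun i =>
    ((continuous_apply i).comp hu.continuous).add continuous_const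
  ge x i p hp := by
    rw [(hdeg x).mulVec_add_const]
    rw [subdifferential_add_const (fun x' => u x' i)] at hp
    exact hu.ge x i p hp

/-- At a contact point of the `i`-th components of a critical subsolution `w` and a critical
supersolution `u` with `w ≤ u`, the coupling term of `w` does not exceed that of `u`. -/
theorem mulVec_le_of_contact (hH : ∀ i, IsConvexHamiltonian (H i))
    (hBcont : ∀ i j, Continuous fun x => B x i j) (hB : ∀ x, IsCouplingMatrix (B x))
    (hirr : ∀ x, IsIrreducibleMatrix (B x)) (hdeg : ∀ x, IsDegenerateMatrix (B x))
    {u w : UnitAddTorus (Fin N) → Fin m → ℝ} (hw : IsViscositySubsolution H B 0 w)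
    (hu : IsViscositySupersolution H B 0 u) {i : Fin m} (hle : ∀ x, w x i ≤ u x i)
    {y : UnitAddTorus (Fin N)} (hy : w y i = u y i) : (B y *ᵥ w y) i ≤ (B y *ᵥ u y) i := by
  obtain ⟨κ, -, hκ⟩ := exists_superdifferential_bound hH hBcont hB hirr hdeg i
  obtain ⟨y, rfl⟩ := torusProj_surjective y
  have hr : ∀ n : ℕ, (0 : ℝ) < 1 / (n + 1) := fun n => Nat.one_div_pos_of_nat
  have hr0 : Filter.Tendsto (fun n : ℕ => (1 : ℝ) / (n + 1)) Filter.atTop (𝓝 0) :=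
    tendsto_one_div_add_atTop_nhds_zero_nat
  choose x z hx hz p hp q hq hpq using fun n =>
    exists_near_superdifferential_subdifferential ((continuous_apply i).comp hw.continuous)
      ((continuous_apply i).comp hu.continuous) hle hy (hr n)
  -- The momenta of `w` are bounded by `κ`; those of `u` inherit the same limit from `hpq`.
  obtain ⟨p₀, -, φ, hφ, hpφ⟩ :=
    (isCompact_closedBall (0 : EuclideanSpace ℝ (Fin N)) κ).tendsto_subseq fun n =>
      mem_closedBall_zero_iff.2 (hκ w hw _ (p n) (hp n))
  have hlim : ∀ {s : ℕ → EuclideanSpace ℝ (Fin N)}, (∀ n, dist (s n) y < 1 / (n + 1)) →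
      Filter.Tendsto (fun n => torusProj (s (φ n))) Filter.atTop (𝓝 (torusProj y)) := by
    intro s hs
    have : Filter.Tendsto s Filter.atTop (𝓝 y) := tendsto_iff_dist_tendsto_zero.2
      (squeeze_zero (fun _ => dist_nonneg) (fun n => (hs n).le) hr0)
    exact ((continuous_torusProj.tendsto y).comp this).comp hφ.tendsto_atTop
  have hqφ : Filter.Tendsto (q ∘ φ) Filter.atTop (𝓝 p₀) := by
    refine (tendsto_iff_of_dist ?_).1 hpφ
    exact (squeeze_zero (fun _ => dist_nonneg) (fun n => (hpq n).le) hr0).comp hφ.tendsto_atTop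
  have hHw : Filter.Tendsto (fun n => H i (torusProj (x (φ n))) (p (φ n))
      + (B (torusProj (x (φ n))) *ᵥ w (torusProj (x (φ n)))) i) Filter.atTop
      (𝓝 (H i (torusProj y) p₀ + (B (torusProj y) *ᵥ w (torusProj y)) i)) :=
    (((hH i).continuous.tendsto (torusProj y, p₀)).comp ((hlim hx).prodMk_nhds hpφ)).add
      (((continuous_mulVec_apply hBcont hw.continuous i).tendsto _).comp (hlim hx))
  have hHu : Filter.Tendsto (fun n => H i (torusProj (z (φ n))) (q (φ n))
      + (B (torusProj (z (φ n))) *ᵥ u (torusProj (z (φ n)))) i) Filter.atTop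
      (𝓝 (H i (torusProj y) p₀ + (B (torusProj y) *ᵥ u (torusProj y)) i)) :=
    (((hH i).continuous.tendsto (torusProj y, p₀)).comp ((hlim hz).prodMk_nhds hqφ)).add
      (((continuous_mulVec_apply hBcont hu.continuous i).tendsto _).comp (hlim hz))
  have h1 := le_of_tendsto' hHw fun n => hw.le _ i _ (hp (φ n))
  have h2 := ge_of_tendsto' hHu fun n => hu.ge _ i _ (hq (φ n))
  exact (add_le_add_iff_left _).1 (h1.trans h2)

/-- A critical subsolution lying below a critical supersolution and touching it at `y` in one
component touches it at `y` in every component. -/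
theorem eq_of_contact (hH : ∀ i, IsConvexHamiltonian (H i))
    (hBcont : ∀ i j, Continuous fun x => B x i j) (hB : ∀ x, IsCouplingMatrix (B x))
    (hirr : ∀ x, IsIrreducibleMatrix (B x)) (hdeg : ∀ x, IsDegenerateMatrix (B x))
    {u w : UnitAddTorus (Fin N) → Fin m → ℝ} (hw : IsViscositySubsolution H B 0 w)
    (hu : IsViscositySupersolution H B 0 u) (hle : ∀ x i, w x i ≤ u x i)
    {y : UnitAddTorus (Fin N)} {j : Fin m} (hj : w y j = u y j) : w y = u y := by
  by_contra hne
  obtain ⟨k, hk⟩ := Function.ne_iff.1 hne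
  obtain ⟨i, hi, hneg⟩ := exists_mulVec_neg (hB y) (hirr y) (w := u y - w y)
    (fun i => sub_nonneg.2 (hle y i)) (sub_eq_zero.2 hj.symm) (sub_ne_zero.2 (Ne.symm hk))
  have := mulVec_le_of_contact hH hBcont hB hirr hdeg hw hu (fun x => hle x i)
    (sub_eq_zero.1 hi).symm
  rw [Matrix.mulVec_sub, Pi.sub_apply] at hneg
  linarith

end System

/-! ### Rigidity at a point of the Aubry set. -/

theorem mainTheorem4 {N m : ℕ}
    (H : Fin m → UnitAddTorus (Fin N) → EuclideanSpace ℝ (Fin N) → ℝ)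
    (B : UnitAddTorus (Fin N) → Matrix (Fin m) (Fin m) ℝ)
    (hH : ∀ i, IsConvexHamiltonian (H i))
    (hBcont : ∀ i j, Continuous fun x => B x i j)
    (hBcoupling : ∀ x, IsCouplingMatrix (B x))
    (hBirred : ∀ x, IsIrreducibleMatrix (B x))
    (hBdeg : ∀ x, IsDegenerateMatrix (B x))
    (hc : criticalValue H B = 0)
    (y : UnitAddTorus (Fin N)) (hy : y ∈ aubrySet H B) :
    -- the suprema that define the Mañé matrix are finite
    (∀ i j x z, IsLUB (maneSet H B i j x z) (maneMatrix H B x z i j)) ∧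
    -- the value at `y` of a critical subsolution
    (∀ i, ∀ v ∈ subsolutions H B 0,
      v y = (maneMatrix H B y y).col i + v y i • (1 : Fin m → ℝ)) ∧
    -- two critical subsolutions differ at `y` by a multiple of the vector of ones
    (∀ v ∈ subsolutions H B 0, ∀ w ∈ subsolutions H B 0,
      v y - w y ∈ Submodule.span ℝ {(1 : Fin m → ℝ)}) ∧
    -- `Φ(y,y)` is antisymmetric
    (maneMatrix H B y y)ᵀ = -maneMatrix H B y y ∧
    -- the columns of `Φ(y,·)` are critical solutions that differ by constants
    (∀ j, IsViscositySolution H B 0 (fun x => (maneMatrix H B y x).col j)) ∧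
    (∀ i j x, (maneMatrix H B y x).col i =
      (maneMatrix H B y x).col j + maneMatrix H B y y j i • (1 : Fin m → ℝ)) := by
  obtain ⟨j₀, hsol⟩ := hy
  have hmem : (fun x => (maneMatrix H B y x).col j₀) ∈ subsolutions H B 0 := hsol.1
  have hlub : ∀ i j x z, IsLUB (maneSet H B i j x z) (maneMatrix H B x z i j) := fun i j x z =>
    isLUB_csSup ⟨_, _, hmem, rfl⟩ (bddAbove_maneSet hH hBcont hBcoupling hBirred hBdeg i j x z)
  -- the value at `y` of a critical subsolution is determined by its `j₀`-th component
  have hval : ∀ v ∈ subsolutions H B 0, ∀ i, v y i = maneMatrix H B y y i j₀ + v y j₀ := by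
    intro v hv i
    have hdiag : maneMatrix H B y y j₀ j₀ = 0 := by
      refine (hlub j₀ j₀ y y).unique ?_
      have : maneSet H B j₀ j₀ y y = {0} :=
        Set.eq_singleton_iff_unique_mem.2 ⟨⟨v, hv, (sub_self _).symm⟩, by
          rintro _ ⟨v, -, rfl⟩; exact sub_self _⟩
      rw [this]
      exact isLUB_singleton
    have h := eq_of_contact hH hBcont hBcoupling hBirred hBdeg
      (hv.add_const hBdeg (-v y j₀)) hsol.2
      (fun x i => (hlub i j₀ y x).1 ⟨v, hv, (sub_eq_add_neg _ _).symm⟩) (y := y) (j := j₀)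
      ((add_neg_cancel _).trans hdiag.symm)
    have := congrFun h i
    simp only [Matrix.col_apply] at this
    linarith
  -- By `hval`, replacing `v_k(y)` with `v_{j₀}(y)` shifts every element of the set by the same
  -- constant, hence also its supremum.
  have hcol : ∀ i k x,
      maneMatrix H B y x i k = maneMatrix H B y x i j₀ - maneMatrix H B y y k j₀ := by
    intro i k x
    refine (hlub i k y x).unique ⟨?_, fun c hc => ?_⟩
    · rintro _ ⟨v, hv, rfl⟩
      have := (hlub i j₀ y x).1 ⟨v, hv, rfl⟩
      linarith [hval v hv k]
    · rw [sub_le_iff_le_add]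
      refine (hlub i j₀ y x).2 ?_
      rintro _ ⟨v, hv, rfl⟩
      have := hc ⟨v, hv, rfl⟩
      linarith [hval v hv k]
  refine ⟨hlub, fun i v hv => ?_, fun v hv w hw => ?_, ?_, fun j => ?_, fun i j x => ?_⟩
  · ext k
    simp only [Pi.add_apply, Pi.smul_apply, Pi.one_apply, smul_eq_mul, mul_one, Matrix.col_apply]
    linarith [hval v hv k, hval v hv i, hcol k i y]
  · refine Submodule.mem_span_singleton.2 ⟨v y j₀ - w y j₀, ?_⟩
    ext k
    simp only [Pi.sub_apply, Pi.smul_apply, Pi.one_apply, smul_eq_mul, mul_one]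
    linarith [hval v hv k, hval w hw k]
  · ext i k
    simp only [Matrix.transpose_apply, Matrix.neg_apply]
    linarith [hcol i k y, hcol k i y]
  · have h : (fun x => (maneMatrix H B y x).col j) =
        fun x i => (maneMatrix H B y x).col j₀ i + -maneMatrix H B y y j j₀ := by
      ext x i
      simpa only [Matrix.col_apply, sub_eq_add_neg] using hcol i j x
    rw [h]
    exact ⟨hsol.1.add_const hBdeg _, hsol.2.add_const hBdeg _⟩
  · ext k
    simp only [Pi.add_apply, Pi.smul_apply, Pi.one_apply, smul_eq_mul, mul_one, Matrix.col_apply]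
    linarith [hcol k i x, hcol k j x, hcol j i y, hcol j j y, hcol j j₀ y, hcol j₀ j₀ y]
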